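/- For a measurable function $w$ on the unit circle (in the variable $\theta\in(-\pi,\pi]$) with $1\le w\le M<\infty$ almost everywhere, let $\Phi_n(z,w)$ denote the $n$-th monic orthogonal polynomial with respect to $w\,d\theta$, i.e. $\Phi_n(\cdot,w)$ has degree $n$ and leading coefficient $1$, and $$\int_{-\pi}^{\pi}\Phi_n(e^{i\theta},w)\,\overline{\Phi_m(e^{i\theta},w)}\,w(\theta)\,d\theta=0\qquad (0\le m<n).$$ Let $\|\cdot\|_\infty$ be the norm of $L^\infty(-\pi,\pi)$. There are absolute constants $C,C_3,C_4>0$ such that for every integer $n\ge 1$ the following holds. 1. If $\epsilon\in(0,1]$, then $$\sup_{1\le w\le 1+\epsilon}\|\Phi_n(e^{i\theta},w)\|_\infty\le C\,n^{C_3\epsilon}.$$ 2. If $T>2$, then $$\sup_{1\le w\le T}\|\Phi_n(e^{i\theta},w)\|_\infty\le C\,T\,n^{\frac12-C_4T^{-1}}.$$ The suprema are over all measurable $w$ satisfying the displayed bounds almost everywhere. -/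

import Mathlib

open MeasureTheory Polynomial
open scoped ENNReal Real

/-- Arc length `dθ` on the unit circle, parametrized by `θ ∈ (-π, π]`; its total mass is `2π`. -/
noncomputable def circleMeasure : Measure ℝ :=
  volume.restrict (Set.Ioc (-π) π)

/-- The trigonometric function `θ ↦ P (e^{iθ})`. -/
noncomputable def onCircle (P : ℂ[X]) (θ : ℝ) : ℂ :=
  P.eval (Complex.exp (θ * Complex.I))

/-- The pairing `∫_{-π}^{π} P(e^{iθ}) conj(Q(e^{iθ})) w(θ) dθ`. -/
noncomputable def weightedPairing (w : ℝ → ℝ) (P Q : ℂ[X]) : ℂ :=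
  ∫ θ, onCircle P θ * (starRingEnd ℂ) (onCircle Q θ) * (w θ : ℂ) ∂circleMeasure

/-- A weight on the circle: integrable, nonnegative, and not identically zero. -/
structure IsWeight (w : ℝ → ℝ) : Prop where
  integrable : Integrable w circleMeasure
  nonneg : ∀ᵐ θ ∂circleMeasure, 0 ≤ w θ
  ne_zero : ¬ ∀ᵐ θ ∂circleMeasure, w θ = 0

/-- `Φ` is the system of monic orthogonal polynomials for `w`: `Φ n` is monic of degree `n`, and
`Φ n` is orthogonal to `Φ m` for `m < n`. -/
structure IsMonicOrthogonalSystem (w : ℝ → ℝ) (Φ : ℕ → ℂ[X]) : Prop where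
  monic : ∀ n, (Φ n).Monic
  natDegree_eq : ∀ n, (Φ n).natDegree = n
  orthogonal : ∀ n m, m < n → weightedPairing w (Φ n) (Φ m) = 0

/-- The monic orthogonal polynomials `Φ_n(z, w)`, obtained from `1, z, z², …` by the Gram–Schmidt
process without normalization. -/
noncomputable def monicOrthogonal (w : ℝ → ℝ) (n : ℕ) : ℂ[X] :=
  X ^ n - ∑ m : Fin n,
    C (weightedPairing w (X ^ n) (monicOrthogonal w m) /
      weightedPairing w (monicOrthogonal w m) (monicOrthogonal w m)) * monicOrthogonal w m
termination_by n
decreasing_by all_goals exact m.isLt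

/-- The (measurable) functions `w` on the circle with `1 ≤ w ≤ M` almost everywhere. -/
structure IsWeightBetween (M : ℝ) (w : ℝ → ℝ) : Prop where
  aemeasurable : AEMeasurable w circleMeasure
  one_le : ∀ᵐ θ ∂circleMeasure, 1 ≤ w θ
  le : ∀ᵐ θ ∂circleMeasure, w θ ≤ M

/-- `sup_{1 ≤ w ≤ M} ‖Φ_n(e^{iθ}, w)‖_{L^∞}`, as an extended nonnegative number. -/
noncomputable def supNormMonicOrthogonal (n : ℕ) (M : ℝ) : ℝ≥0∞ :=
  ⨆ (w : ℝ → ℝ) (_ : IsWeightBetween M w),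
    eLpNorm (onCircle (monicOrthogonal w n)) ∞ circleMeasure

/-! The remaining facts show that the definitions describe the intended objects. -/

theorem continuous_onCircle (P : ℂ[X]) : Continuous (onCircle P) := by
  unfold onCircle
  fun_prop

theorem IsWeightBetween.isWeight {M : ℝ} {w : ℝ → ℝ} (h : IsWeightBetween M w) : IsWeight w where
  integrable := by
    have : IsFiniteMeasure circleMeasure := by unfold circleMeasure; infer_instance
    refine Integrable.of_bound (C := M) h.aemeasurable.aestronglyMeasurable ?_
    filter_upwards [h.one_le, h.le] with θ h1 h2
    rw [Real.norm_eq_abs, abs_of_nonneg (by linarith)]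
    exact h2
  nonneg := by
    filter_upwards [h.one_le] with θ h1
    linarith
  ne_zero := by
    intro h0
    have hf : ∀ᵐ θ ∂circleMeasure, False := by
      filter_upwards [h.one_le, h0] with θ h1 h2
      linarith
    have h3 : circleMeasure = 0 := by simpa using hf
    have h4 : circleMeasure Set.univ = 0 := by rw [h3]; simp
    simp [circleMeasure] at h4
    linarith [Real.pi_pos]

theorem integrable_pairing {w : ℝ → ℝ} (hw : IsWeight w) (P Q : ℂ[X]) :
    Integrable (fun θ => onCircle P θ * (starRingEnd ℂ) (onCircle Q θ) * (w θ : ℂ))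
      circleMeasure := by
  have hc : Continuous fun θ => onCircle P θ * (starRingEnd ℂ) (onCircle Q θ) :=
    (continuous_onCircle P).mul (Complex.continuous_conj.comp (continuous_onCircle Q))
  obtain ⟨B, hB⟩ := (isCompact_Icc (a := -π) (b := π)).exists_bound_of_continuousOn hc.continuousOn
  refine Integrable.bdd_mul (c := B) hw.integrable.ofReal hc.aestronglyMeasurable ?_
  unfold circleMeasure
  filter_upwards [ae_restrict_mem measurableSet_Ioc] with θ hθ
  exact hB θ ⟨hθ.1.le, hθ.2⟩

theorem pairing_sub {w : ℝ → ℝ} (hw : IsWeight w) (P Q R : ℂ[X]) :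
    weightedPairing w (P - Q) R = weightedPairing w P R - weightedPairing w Q R := by
  unfold weightedPairing
  rw [← integral_sub (integrable_pairing hw P R) (integrable_pairing hw Q R)]
  congr 1
  funext θ
  simp only [onCircle, eval_sub]
  ring

theorem pairing_sum_C_mul {w : ℝ → ℝ} (hw : IsWeight w) {ι : Type*} (s : Finset ι) (c : ι → ℂ)
    (P : ι → ℂ[X]) (R : ℂ[X]) :
    weightedPairing w (∑ i ∈ s, C (c i) * P i) R = ∑ i ∈ s, c i * weightedPairing w (P i) R := by
  unfold weightedPairing
  simp_rw [← integral_const_mul]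
  rw [← integral_finsetSum s fun i _ => (integrable_pairing hw (P i) R).const_mul (c i)]
  congr 1
  funext θ
  simp only [onCircle, eval_finsetSum, eval_mul, eval_C, Finset.sum_mul, mul_assoc]

theorem pairing_conj (w : ℝ → ℝ) (P Q : ℂ[X]) :
    (starRingEnd ℂ) (weightedPairing w P Q) = weightedPairing w Q P := by
  unfold weightedPairing
  rw [← integral_conj]
  congr 1
  funext θ
  simp only [map_mul, Complex.conj_conj, Complex.conj_ofReal]
  ring

theorem ae_onCircle_ne_zero {P : ℂ[X]} (hP : P ≠ 0) : ∀ᵐ θ ∂circleMeasure, onCircle P θ ≠ 0 := by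
  have hinj : Set.InjOn (fun θ : ℝ => Complex.exp (θ * Complex.I)) (Set.Ioc (-π) π) := by
    intro x hx y hy hxy
    refine Circle.exp_injOn_Ioc (a := -π) (b := π) (by linarith) hx hy ?_
    exact Circle.ext (by simpa using hxy)
  have hfin : {θ ∈ Set.Ioc (-π) π | onCircle P θ = 0}.Finite := by
    refine Set.Finite.of_finite_image (f := fun θ : ℝ => Complex.exp (θ * Complex.I))
      ((P.finite_setOfPred_isRoot hP).subset ?_) (hinj.mono fun θ hθ => hθ.1)
    rintro _ ⟨θ, hθ, rfl⟩
    exact hθ.2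
  rw [circleMeasure, ae_restrict_iff' measurableSet_Ioc]
  have h0 := hfin.measure_zero volume
  rw [measure_eq_zero_iff_ae_notMem] at h0
  filter_upwards [h0] with θ h1 h2 h3
  exact h1 ⟨h2, h3⟩

theorem pairing_self_ne_zero {w : ℝ → ℝ} (hw : IsWeight w) {P : ℂ[X]} (hP : P ≠ 0) :
    weightedPairing w P P ≠ 0 := by
  intro h
  have h1 : weightedPairing w P P = ((∫ θ, ‖onCircle P θ‖ ^ 2 * w θ ∂circleMeasure : ℝ) : ℂ) := by
    rw [← integral_complex_ofReal]
    unfold weightedPairing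
    congr 1
    funext θ
    rw [Complex.mul_conj, Complex.normSq_eq_norm_sq]
    push_cast
    ring
  rw [h1, Complex.ofReal_eq_zero, integral_eq_zero_iff_of_nonneg_ae] at h
  · apply hw.ne_zero
    filter_upwards [h, ae_onCircle_ne_zero hP] with θ h2 h3
    simpa [h3] using h2
  · filter_upwards [hw.nonneg] with θ h2
    positivity
  · have := (integrable_pairing hw P P).re
    refine this.congr (Filter.Eventually.of_forall fun θ => ?_)
    simp only [Complex.mul_conj, Complex.normSq_eq_norm_sq]
    simp [← Complex.ofReal_pow]

theorem monicOrthogonal_degree (w : ℝ → ℝ) (n : ℕ) :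
    (monicOrthogonal w n).Monic ∧ (monicOrthogonal w n).natDegree = n := by
  induction n using Nat.strong_induction_on with
  | _ n ih =>
    have hdeg : (∑ m : Fin n,
        C (weightedPairing w (X ^ n) (monicOrthogonal w m) /
          weightedPairing w (monicOrthogonal w m) (monicOrthogonal w m)) *
            monicOrthogonal w m).degree < (n : WithBot ℕ) := by
      refine (degree_sum_le _ _).trans_lt ((Finset.sup_lt_iff (WithBot.bot_lt_coe n)).2 ?_)
      intro m _
      rw [← smul_eq_C_mul]
      refine (degree_smul_le _ _).trans_lt ?_
      refine degree_le_natDegree.trans_lt ?_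
      rw [(ih m m.isLt).2]
      exact Nat.cast_lt.2 m.isLt
    rw [monicOrthogonal]
    refine ⟨monic_X_pow_sub hdeg, natDegree_eq_of_degree_eq_some ?_⟩
    rw [degree_sub_eq_left_of_degree_lt (by rwa [degree_X_pow]), degree_X_pow]

/-- The Gram–Schmidt construction does give the monic orthogonal polynomials of every weight. -/
theorem isMonicOrthogonalSystem_monicOrthogonal {w : ℝ → ℝ} (hw : IsWeight w) :
    IsMonicOrthogonalSystem w (monicOrthogonal w) where
  monic n := (monicOrthogonal_degree w n).1
  natDegree_eq n := (monicOrthogonal_degree w n).2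
  orthogonal n := by
    induction n using Nat.strong_induction_on with
    | _ n ih =>
      intro m hm
      rw [monicOrthogonal, pairing_sub hw, pairing_sum_C_mul hw,
        Finset.sum_eq_single (⟨m, hm⟩ : Fin n)]
      · rw [div_mul_cancel₀, sub_self]
        exact pairing_self_ne_zero hw (monicOrthogonal_degree w m).1.ne_zero
      · intro k _ hk
        have hk' : (k : ℕ) ≠ m := fun h => hk (Fin.ext h)
        rcases lt_or_gt_of_ne hk' with h | h
        · rw [← pairing_conj w (monicOrthogonal w m), ih m hm k h]; simp
        · rw [ih k k.isLt m h]; simp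
      · simp

/-- The monic orthogonal polynomials of a weight are unique. -/
theorem IsMonicOrthogonalSystem.eq_monicOrthogonal {w : ℝ → ℝ} (hw : IsWeight w) {Φ : ℕ → ℂ[X]}
    (h : IsMonicOrthogonalSystem w Φ) (n : ℕ) : Φ n = monicOrthogonal w n := by
  have hΨ := isMonicOrthogonalSystem_monicOrthogonal hw
  induction n using Nat.strong_induction_on with
  | _ n ih =>
    have hD : ∀ m < n, weightedPairing w (Φ n - monicOrthogonal w n) (monicOrthogonal w m) = 0 := by
      intro m hm
      rw [pairing_sub hw, hΨ.orthogonal n m hm, ← ih m hm, h.orthogonal n m hm, sub_zero]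
    have hlow : ∀ k ≤ n, ∀ R : ℂ[X], R.degree < (k : WithBot ℕ) →
        weightedPairing w R (Φ n - monicOrthogonal w n) = 0 := by
      intro k
      induction k with
      | zero =>
        intro _ R hR
        have hR0 : R = 0 := degree_eq_bot.1 (Nat.WithBot.lt_zero_iff.1 (by simpa using hR))
        simp [hR0, weightedPairing, onCircle]
      | succ k ihk =>
        intro hk R hR
        by_cases hRk : R.degree < (k : WithBot ℕ)
        · exact ihk (by omega) R hRk
        have hR0 : R ≠ 0 := by
          rintro rfl
          simp at hRk
        have hRk' : R.degree = k := by
          rw [degree_eq_natDegree hR0, Nat.cast_lt] at hR hRk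
          rw [degree_eq_natDegree hR0, Nat.cast_inj]
          omega
        have hΨk : (monicOrthogonal w k).degree = k := by
          rw [degree_eq_natDegree (hΨ.monic k).ne_zero, hΨ.natDegree_eq k]
        have hlc : R.leadingCoeff ≠ 0 := leadingCoeff_ne_zero.2 hR0
        have hsub : (R - C R.leadingCoeff * monicOrthogonal w k).degree < R.degree := by
          refine degree_sub_lt_left ?_ hR0 ?_
          · rw [degree_C_mul hlc, hΨk, hRk']
          · rw [leadingCoeff_mul, leadingCoeff_C, (hΨ.monic k).leadingCoeff, mul_one]
        have h1 := ihk (by omega) _ (hRk' ▸ hsub)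
        have h2 : weightedPairing w (C R.leadingCoeff * monicOrthogonal w k)
            (Φ n - monicOrthogonal w n) = 0 := by
          have := pairing_sum_C_mul hw (Finset.univ : Finset Unit) (fun _ => R.leadingCoeff)
            (fun _ => monicOrthogonal w k) (Φ n - monicOrthogonal w n)
          simp only [Finset.univ_unique, Finset.sum_singleton] at this
          rw [this, ← pairing_conj, hD k (by omega), map_zero, mul_zero]
        rw [pairing_sub hw, h2, sub_zero] at h1
        exact h1
    by_contra hne
    have hne' : Φ n - monicOrthogonal w n ≠ 0 := sub_ne_zero.2 hne
    refine pairing_self_ne_zero hw hne' (hlow n le_rfl _ ?_)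
    have hd : (Φ n).degree = n := by
      rw [degree_eq_natDegree (h.monic n).ne_zero, h.natDegree_eq n]
    have hd' : (monicOrthogonal w n).degree = n := by
      rw [degree_eq_natDegree (hΨ.monic n).ne_zero, hΨ.natDegree_eq n]
    have := degree_sub_lt_left (hd.trans hd'.symm) (h.monic n).ne_zero
      ((h.monic n).leadingCoeff.trans (hΨ.monic n).leadingCoeff.symm)
    rwa [hd] at this

/-! Let `proj_n` be the projection onto the span of `1, …, z^{n-1}`. Orthogonality says `proj_n (w
Φ_n) = 0`, and monicity says `Φ_n - proj_n Φ_n = z^n`. Hence, for any constant `c`, `Φ_n = z^n +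
proj_n ((1 - w/c) Φ_n)` (`monicOrthogonal_eq_add_multProj`). The operator on the right is controlled
in `L^p` by M. Riesz's theorem with a constant linear in `p` (`lpNorm_circleProj_le`), and `L^p`
bounds become uniform ones through Nikolskii's inequality, at a cost of about `n^{1/p}`
(`norm_onCircle_pow_le`).

For `w` close to `1`, take `c = 1`. The multiplier is at most `ε`, so the operator has norm at most
`2pε` on `L^p`. With `p` a power of two comparable to `1/ε` this is at most `1/2`, so `‖Φ_n‖_p ≤ 2
‖z^n‖_p`, and Nikolskii gives `n^{1/p}` with `1/p ≤ 8ε`.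

For `w ≤ T`, take `c = T`. The operator contracts `L²` by `q = 1 - 1/T` and has norm at most `8` on
`L⁴`. The `j`-th term of the Neumann series is therefore bounded pointwise both by `2 n^{1/2} q^j`
and by `2 n^{1/4} 8^j`. A weighted geometric mean of these two numbers, with weight `t = 1/(6T)` on
the second, keeps a ratio below `1` by an amount of order `1/T` while lowering the power of `n` by
`t/4`. Summing the geometric series costs the factor `T`. Interpolating numbers rather than
operators makes Riesz–Thorin unnecessary. -/

/-! ### Polynomials on the circle and their Fourier coefficients. -/

instance : IsFiniteMeasure circleMeasure := by unfold circleMeasure; infer_instance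

theorem circleMeasure_real_univ : circleMeasure.real Set.univ = 2 * π := by
  simp [circleMeasure, Measure.real, ENNReal.toReal_ofReal, Real.pi_pos.le]
  ring

theorem onCircle_mul (P Q : ℂ[X]) : onCircle (P * Q) = onCircle P * onCircle Q := by
  ext θ; simp [onCircle]

theorem onCircle_add (P Q : ℂ[X]) : onCircle (P + Q) = onCircle P + onCircle Q := by
  ext θ; simp [onCircle]

theorem onCircle_sub (P Q : ℂ[X]) : onCircle (P - Q) = onCircle P - onCircle Q := by
  ext θ; simp [onCircle]

theorem onCircle_pow (P : ℂ[X]) (j : ℕ) : onCircle (P ^ j) = fun θ => onCircle P θ ^ j := by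
  ext θ; simp [onCircle]

theorem norm_onCircle_X_pow (j : ℕ) (θ : ℝ) : ‖onCircle (X ^ j) θ‖ = 1 := by
  simp [onCircle, Complex.norm_exp_ofReal_mul_I]

theorem memLp_onCircle (P : ℂ[X]) (p : ℝ≥0∞) : MemLp (onCircle P) p circleMeasure := by
  obtain ⟨B, hB⟩ := (isCompact_Icc (a := -π) (b := π)).exists_bound_of_continuousOn
    (continuous_onCircle P).continuousOn
  refine MemLp.of_bound (continuous_onCircle P).aestronglyMeasurable B ?_
  unfold circleMeasure
  filter_upwards [ae_restrict_mem measurableSet_Ioc] with θ hθ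
  exact hB θ ⟨hθ.1.le, hθ.2⟩

theorem conj_onCircle_memLp (P : ℂ[X]) (p : ℝ≥0∞) :
    MemLp (fun θ => (starRingEnd ℂ) (onCircle P θ)) p circleMeasure := by
  refine (memLp_onCircle P p).of_le
    (Complex.continuous_conj.comp (continuous_onCircle P)).aestronglyMeasurable ?_
  exact Filter.Eventually.of_forall fun θ => by simp

theorem integrable_mul_conj_onCircle {g : ℝ → ℂ} (hg : Integrable g circleMeasure) (P : ℂ[X]) :
    Integrable (fun θ => g θ * (starRingEnd ℂ) (onCircle P θ)) circleMeasure := by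
  exact hg.mul_of_top_left (conj_onCircle_memLp P ∞)

theorem integral_X_pow_mul_conj (i j : ℕ) :
    ∫ θ, onCircle (X ^ i) θ * (starRingEnd ℂ) (onCircle (X ^ j) θ) ∂circleMeasure =
      if i = j then 2 * π else 0 := by
  have key : ∀ θ : ℝ, onCircle (X ^ i) θ * (starRingEnd ℂ) (onCircle (X ^ j) θ) =
      Complex.exp ((((i : ℂ) - j) * Complex.I) * θ) := by
    intro θ
    simp only [onCircle, eval_pow, eval_X, ← Complex.exp_conj, ← Complex.exp_nat_mul,
      ← Complex.exp_add]
    congr 1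
    simp
    ring
  simp_rw [key]
  unfold circleMeasure
  rw [← intervalIntegral.integral_of_le (by linarith [Real.pi_pos])]
  split_ifs with h
  · subst h
    simp
    ring
  · have hc : ((i : ℂ) - j) * Complex.I ≠ 0 :=
      mul_ne_zero (sub_ne_zero.2 (by exact_mod_cast h)) Complex.I_ne_zero
    rw [integral_exp_mul_complex hc, Complex.ofReal_zero, div_eq_zero_iff]
    left
    rw [sub_eq_zero, Complex.exp_eq_exp_iff_exists_int]
    refine ⟨(i : ℤ) - j, ?_⟩
    push_cast
    ring

theorem integral_mul_conj_onCircle {g : ℝ → ℂ} (hg : Integrable g circleMeasure) (P : ℂ[X]) :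
    ∫ θ, g θ * (starRingEnd ℂ) (onCircle P θ) ∂circleMeasure =
      ∑ j ∈ Finset.range (P.natDegree + 1), (starRingEnd ℂ) (P.coeff j) *
        ∫ θ, g θ * (starRingEnd ℂ) (onCircle (X ^ j) θ) ∂circleMeasure := by
  simp_rw [← integral_const_mul]
  rw [← integral_finsetSum _ fun j _ => (integrable_mul_conj_onCircle hg (X ^ j)).const_mul _]
  congr 1
  funext θ
  simp only [onCircle, eval_eq_sum_range (p := P), map_sum, Finset.mul_sum, map_mul, eval_pow,
    eval_X]
  exact Finset.sum_congr rfl fun j _ => by ring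

theorem integral_onCircle_mul_conj_X_pow (P : ℂ[X]) (j : ℕ) :
    ∫ θ, onCircle P θ * (starRingEnd ℂ) (onCircle (X ^ j) θ) ∂circleMeasure =
      2 * π * P.coeff j := by
  have h := integral_mul_conj_onCircle ((memLp_onCircle (X ^ j) 1).integrable le_rfl) P
  have h2 := congrArg (starRingEnd ℂ) h
  rw [← integral_conj] at h2
  simp only [map_mul, map_sum, Complex.conj_conj, integral_X_pow_mul_conj] at h2
  rw [show (fun θ => onCircle P θ * (starRingEnd ℂ) (onCircle (X ^ j) θ)) = fun θ =>
    (starRingEnd ℂ) (onCircle (X ^ j) θ) * onCircle P θ from funext fun θ => mul_comm _ _, h2]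
  by_cases hj : j < P.natDegree + 1
  · rw [Finset.sum_eq_single_of_mem j (Finset.mem_range.2 hj)]
    · simp only [if_true, Complex.conj_ofReal]; push_cast; ring
    · intro i _ hi
      simp [hi.symm]
  · rw [coeff_eq_zero_of_natDegree_lt (by omega), mul_zero]
    refine Finset.sum_eq_zero fun i hi => ?_
    rw [Finset.mem_range] at hi
    simp [show j ≠ i by omega]

/-! ### Real-valued `L^p` norms: powers and Hölder. -/

section lpNorm
variable {α : Type*} [MeasurableSpace α] {μ : Measure α}

theorem lpNorm_pow_eq_integral {f : α → ℂ} (hf : AEStronglyMeasurable f μ) {p : ℕ} (hp : 0 < p) :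
    lpNorm f p μ ^ p = ∫ x, ‖f x‖ ^ p ∂μ := by
  rw [lpNorm_eq_integral_norm_rpow_toReal (by simpa using hp.ne') (by simp) hf]
  simp only [ENNReal.toReal_natCast, Real.rpow_natCast]
  rw [← Real.rpow_natCast, ← Real.rpow_mul (by positivity), inv_mul_cancel₀ (by positivity),
    Real.rpow_one]

theorem lpNorm_pow {f : α → ℂ} (hf : AEStronglyMeasurable f μ) {p j : ℕ} (hp : 0 < p)
    (hj : 0 < j) : lpNorm (fun x => f x ^ j) p μ = lpNorm f (j * p : ℕ) μ ^ j := by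
  refine (pow_left_inj₀ lpNorm_nonneg (pow_nonneg lpNorm_nonneg _) hp.ne').1 ?_
  rw [lpNorm_pow_eq_integral (f := fun x => f x ^ j) (hf.pow j) hp, ← pow_mul, lpNorm_pow_eq_integral hf (by positivity)]
  simp [pow_mul]

theorem lpNorm_mul_le {f g : α → ℂ} {p q r : ℝ≥0∞} [ENNReal.HolderTriple p q r] (hf : MemLp f p μ)
    (hg : MemLp g q μ) : lpNorm (f * g) r μ ≤ lpNorm f p μ * lpNorm g q μ := by
  have h := eLpNorm_smul_le_mul_eLpNorm (p := p) (q := q) (r := r) hg.1 hf.1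
  rw [smul_eq_mul] at h
  rw [← toReal_eLpNorm (hf.1.mul hg.1), ← toReal_eLpNorm hf.1, ← toReal_eLpNorm hg.1,
    ← ENNReal.toReal_mul]
  exact ENNReal.toReal_mono (ENNReal.mul_ne_top hf.2.ne hg.2.ne) h

theorem holderTriple_two_mul (p : ℕ) :
    ENNReal.HolderTriple ((2 * p : ℕ) : ℝ≥0∞) ((2 * p : ℕ) : ℝ≥0∞) (p : ℝ≥0∞) where
  inv_add_inv_eq_inv := by
    push_cast
    rw [ENNReal.mul_inv (by simp) (by simp), ← add_mul, ENNReal.inv_two_add_inv_two, one_mul]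

end lpNorm

theorem MemLp.of_top {g : ℝ → ℂ} (hg : MemLp g ∞ circleMeasure) (p : ℝ≥0∞) :
    MemLp g p circleMeasure := hg.mono_exponent le_top

/-! ### M. Riesz's theorem for polynomials. -/

/-- Pythagoras in `L²` of the circle. -/
theorem lpNorm_add_sq {f h : ℝ → ℂ} (hf : MemLp f ∞ circleMeasure) (hh : MemLp h ∞ circleMeasure)
    (ho : ∫ θ, f θ * (starRingEnd ℂ) (h θ) ∂circleMeasure = 0) :
    lpNorm (f + h) (2 : ℕ) circleMeasure ^ 2 =
      lpNorm f (2 : ℕ) circleMeasure ^ 2 + lpNorm h (2 : ℕ) circleMeasure ^ 2 := by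
  have hc : MemLp (fun θ => (starRingEnd ℂ) (h θ)) ∞ circleMeasure :=
    hh.of_le (Complex.continuous_conj.comp_aestronglyMeasurable hh.1)
      (Filter.Eventually.of_forall fun θ => by simp)
  have hfh : Integrable (fun θ => f θ * (starRingEnd ℂ) (h θ)) circleMeasure := by
    exact ((MemLp.of_top hf 1).integrable le_rfl).mul_of_top_left hc
  have hsq : ∀ g : ℝ → ℂ, MemLp g ∞ circleMeasure →
      Integrable (fun θ => ‖g θ‖ ^ 2) circleMeasure := fun g hg =>
    (MemLp.of_top hg 2).integrable_norm_pow (by norm_num)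
  rw [lpNorm_pow_eq_integral (hf.add hh).1 two_pos, lpNorm_pow_eq_integral hf.1 two_pos,
    lpNorm_pow_eq_integral hh.1 two_pos, ← integral_add (hsq f hf) (hsq h hh)]
  have hre : ∫ θ, 2 * (f θ * (starRingEnd ℂ) (h θ)).re ∂circleMeasure = 0 := by
    rw [integral_const_mul]
    have := integral_re hfh
    simp only [RCLike.re_to_complex] at this
    rw [this, ho]; simp
  rw [← sub_eq_zero, ← integral_sub (hsq _ (hf.add hh))
    (g := fun θ => ‖f θ‖ ^ 2 + ‖h θ‖ ^ 2) ((hsq f hf).add (hsq h hh)), ← hre]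
  congr 1
  funext θ
  simp only [Pi.add_apply, ← Complex.normSq_eq_norm_sq, Complex.normSq_add]
  ring

/-- M. Riesz's theorem for polynomials on the circle: cutting off the coefficients of degree less
than `m` is bounded in `L^p` for `p = 2, 4, 8, …`, with norm at most `p - 1`. -/
theorem lpNorm_tail_le (k m : ℕ) (f h : ℂ[X]) (hf : X ^ m ∣ f) (hh : h.degree < m) :
    lpNorm (onCircle f) (2 ^ (k + 1) : ℕ) circleMeasure ≤
      (2 ^ (k + 1) - 1) * lpNorm (onCircle (f + h)) (2 ^ (k + 1) : ℕ) circleMeasure := by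
  induction k generalizing m f h with
  | zero =>
    have ho : ∫ θ, onCircle f θ * (starRingEnd ℂ) (onCircle h θ) ∂circleMeasure = 0 := by
      rw [integral_mul_conj_onCircle ((memLp_onCircle f 1).integrable le_rfl)]
      refine Finset.sum_eq_zero fun j _ => ?_
      rw [integral_onCircle_mul_conj_X_pow]
      by_cases hj : j < m
      · rw [X_pow_dvd_iff.1 hf j hj]; simp
      · rw [coeff_eq_zero_of_degree_lt (hh.trans_le (by exact_mod_cast not_lt.1 hj))]; simp
    have := lpNorm_add_sq (memLp_onCircle f ∞) (memLp_onCircle h ∞) ho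
    rw [← onCircle_add] at this
    rw [zero_add, pow_one, pow_one, show (2 : ℝ) - 1 = 1 by norm_num, one_mul]
    refine abs_le_of_sq_le_sq' ?_ lpNorm_nonneg |>.2
    rw [this]
    nlinarith [sq_nonneg (lpNorm (onCircle h) (2 : ℕ) circleMeasure)]
  | succ k ih =>
    -- Cotlar's doubling trick: `f²` is the tail, cut at `2m`, of `f² - h² = (f + h)(f - h)`. The
    -- bound in `L^p` for these squares then yields one in `L^{2p}` for `f`.
    have hf2 : X ^ (2 * m) ∣ f ^ 2 := by rw [mul_comm, pow_mul]; exact pow_dvd_pow_of_dvd hf 2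
    have hh2 : (-h ^ 2).degree < ((2 * m : ℕ) : WithBot ℕ) := by
      by_cases h0 : h = 0
      · rw [h0, show -(0 : ℂ[X]) ^ 2 = 0 by simp, degree_zero]; exact WithBot.bot_lt_coe _
      · rw [degree_neg, degree_pow]
        rw [degree_eq_natDegree h0] at hh ⊢
        norm_cast at hh ⊢
        simp; omega
    have h1 := ih (2 * m) (f ^ 2) (-h ^ 2) hf2 hh2
    set p := 2 ^ (k + 1) with hp
    have hp0 : 0 < p := by positivity
    have hpe : 2 ^ (k + 1 + 1) = 2 * p := by rw [hp]; ring
    have hpr : (2 : ℝ) ^ (k + 1) = p := by rw [hp]; push_cast; ring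
    have hpr2 : (2 : ℝ) ^ (k + 1 + 1) = 2 * p := by rw [← hpr]; ring
    rw [hpe, hpr2]
    rw [hpr] at h1
    -- With `F = f + h` the other factor is `f - h = 2f - F`, so only the norms of `f` and `F`
    -- enter.
    have h2 : onCircle (f ^ 2 + -h ^ 2) =
        onCircle (f + h) * (onCircle f + (onCircle f - onCircle (f + h))) := by
      rw [← onCircle_sub, ← onCircle_add, ← onCircle_mul]; congr 1; ring
    have : Fact ((1 : ℝ≥0∞) ≤ (2 * p : ℕ)) := ⟨by exact_mod_cast (by omega : 1 ≤ 2 * p)⟩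
    have hm := fun P => memLp_onCircle P (2 * p : ℕ)
    have := holderTriple_two_mul p
    have h3 := lpNorm_mul_le (r := (p : ℝ≥0∞)) (hm (f + h))
      ((hm f).add ((hm f).sub (hm (f + h))))
    rw [← h2] at h3
    rw [onCircle_pow, lpNorm_pow (memLp_onCircle f 1).1 hp0 two_pos] at h1
    have h4 := lpNorm_add_le (g := onCircle f - onCircle (f + h)) (hm f) Fact.out
    have h5 := lpNorm_sub_le (g := onCircle (f + h)) (hm f) Fact.out
    set a := lpNorm (onCircle f) (2 * p : ℕ) circleMeasure
    set b := lpNorm (onCircle (f + h)) (2 * p : ℕ) circleMeasure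
    have ha : 0 ≤ a := lpNorm_nonneg
    have hb : 0 ≤ b := lpNorm_nonneg
    have hp1 : (1 : ℝ) ≤ p := by exact_mod_cast hp0
    have h6 : a ^ 2 ≤ (p - 1) * (b * (2 * a + b)) :=
      h1.trans (mul_le_mul_of_nonneg_left (h3.trans (mul_le_mul_of_nonneg_left (by linarith) hb))
        (by linarith))
    -- The quadratic inequality `a² ≤ (p - 1)(2ab + b²)` fails once `a > (2p - 1) b`; this carries
    -- the constant from `p - 1` to `2p - 1`.
    by_contra! hlt
    have h7 : 0 ≤ (p - 1 : ℝ) * b := mul_nonneg (by linarith) hb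
    nlinarith [mul_nonneg h7 hb]

/-! ### Parseval and Nikolskii inequalities. -/

theorem lpNorm_two_sq_onCircle (F : ℂ[X]) :
    lpNorm (onCircle F) (2 : ℕ) circleMeasure ^ 2 =
      2 * π * ∑ j ∈ Finset.range (F.natDegree + 1), ‖F.coeff j‖ ^ 2 := by
  have h := integral_mul_conj_onCircle ((memLp_onCircle F 1).integrable le_rfl) F
  simp_rw [integral_onCircle_mul_conj_X_pow, Complex.mul_conj, Complex.normSq_eq_norm_sq] at h
  rw [integral_complex_ofReal, ← lpNorm_pow_eq_integral (memLp_onCircle F 1).1 two_pos] at h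
  have h2 : ∀ c : ℂ, (starRingEnd ℂ) c * (2 * π * c) = ((2 * π * ‖c‖ ^ 2 : ℝ) : ℂ) := by
    intro c
    rw [mul_left_comm, Complex.conj_mul']
    push_cast
    ring
  simp_rw [h2] at h
  rw [Finset.mul_sum]
  exact_mod_cast h

/-- Cauchy–Schwarz on the coefficients, followed by Parseval. Applied to powers `F ^ j`, it gives
the `L^{2j}` version. -/
theorem norm_onCircle_sq_le (F : ℂ[X]) (θ : ℝ) :
    ‖onCircle F θ‖ ^ 2 ≤ (F.natDegree + 1) / (2 * π) *
      lpNorm (onCircle F) (2 : ℕ) circleMeasure ^ 2 := by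
  have h1 : ‖onCircle F θ‖ ≤ ∑ j ∈ Finset.range (F.natDegree + 1), ‖F.coeff j‖ := by
    unfold onCircle
    rw [eval_eq_sum_range]
    refine (norm_sum_le _ _).trans (Finset.sum_le_sum fun j _ => ?_)
    rw [norm_mul, norm_pow, Complex.norm_exp_ofReal_mul_I, one_pow, mul_one]
  have h2 := sq_sum_le_card_mul_sum_sq (s := Finset.range (F.natDegree + 1))
    (f := fun j => ‖F.coeff j‖)
  rw [lpNorm_two_sq_onCircle, ← mul_assoc, div_mul_cancel₀ _ (by positivity)]
  refine (pow_le_pow_left₀ (norm_nonneg _) h1 2).trans (h2.trans ?_)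
  simp

/-- Nikolskii's inequality between `L^∞` and `L^{2j}`. -/
theorem norm_onCircle_pow_le (F : ℂ[X]) {j : ℕ} (hj : 0 < j) (θ : ℝ) :
    ‖onCircle F θ‖ ^ (2 * j) ≤ (F.natDegree * j + 1) / (2 * π) *
      lpNorm (onCircle F) (2 * j : ℕ) circleMeasure ^ (2 * j) := by
  have h := norm_onCircle_sq_le (F ^ j) θ
  rw [onCircle_pow, lpNorm_pow (memLp_onCircle F 1).1 two_pos hj, norm_pow, ← pow_mul, ← pow_mul,
    mul_comm j 2, natDegree_pow] at h
  simpa [mul_comm] using h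

/-! ### The projection onto low frequencies and its `L^p` bounds. -/

/-- The Fourier coefficient `(2π)⁻¹ ∫ g(θ) e^{-ijθ} dθ` for `j ≥ 0`. -/
noncomputable def circleCoeff (g : ℝ → ℂ) (j : ℕ) : ℂ :=
  (2 * π : ℂ)⁻¹ * ∫ θ, g θ * (starRingEnd ℂ) (onCircle (X ^ j) θ) ∂circleMeasure

/-- The projection onto the span of `1, z, …, z^{n-1}`. -/
noncomputable def circleProj (n : ℕ) (g : ℝ → ℂ) : ℂ[X] :=
  ∑ j ∈ Finset.range n, C (circleCoeff g j) * X ^ j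

theorem coeff_circleProj (n : ℕ) (g : ℝ → ℂ) (i : ℕ) :
    (circleProj n g).coeff i = if i < n then circleCoeff g i else 0 := by
  simp [circleProj, finsetSum_coeff, coeff_X_pow]

theorem degree_circleProj_lt (n : ℕ) (g : ℝ → ℂ) : (circleProj n g).degree < n := by
  rw [degree_lt_iff_coeff_zero]
  intro i hi
  rw [coeff_circleProj, if_neg (by omega)]

theorem natDegree_circleProj_le (n : ℕ) (g : ℝ → ℂ) : (circleProj n g).natDegree ≤ n :=
  natDegree_le_of_degree_le (degree_circleProj_lt n g).le

theorem circleCoeff_sub {f g : ℝ → ℂ} (hf : Integrable f circleMeasure)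
    (hg : Integrable g circleMeasure) (j : ℕ) :
    circleCoeff (f - g) j = circleCoeff f j - circleCoeff g j := by
  unfold circleCoeff
  rw [← mul_sub, ← integral_sub (integrable_mul_conj_onCircle hf _)
    (integrable_mul_conj_onCircle hg _)]
  simp [sub_mul]

theorem circleProj_sub {f g : ℝ → ℂ} (hf : Integrable f circleMeasure)
    (hg : Integrable g circleMeasure) (n : ℕ) :
    circleProj n (f - g) = circleProj n f - circleProj n g := by
  simp [circleProj, circleCoeff_sub hf hg, sub_mul, Finset.sum_sub_distrib]

theorem circleCoeff_onCircle (P : ℂ[X]) (j : ℕ) : circleCoeff (onCircle P) j = P.coeff j := by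
  unfold circleCoeff
  rw [integral_onCircle_mul_conj_X_pow, inv_mul_cancel_left₀]
  exact_mod_cast (by positivity : (2 * π : ℝ) ≠ 0)

/-- The projection is a contraction of `L²`. -/
theorem lpNorm_two_circleProj_le {g : ℝ → ℂ} (hg : MemLp g ∞ circleMeasure) (n : ℕ) :
    lpNorm (onCircle (circleProj n g)) (2 : ℕ) circleMeasure ≤
      lpNorm g (2 : ℕ) circleMeasure := by
  set F := circleProj n g with hF
  have hgi : Integrable g circleMeasure := (MemLp.of_top hg 1).integrable le_rfl
  have hFi : Integrable (onCircle F) circleMeasure := (memLp_onCircle F 1).integrable le_rfl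
  -- The coefficients of `g - F` of index below `n` vanish, and `F` has no others, so Pythagoras
  -- applies.
  have ho : ∫ θ, (g - onCircle F) θ * (starRingEnd ℂ) (onCircle F θ) ∂circleMeasure = 0 := by
    rw [integral_mul_conj_onCircle (hgi.sub hFi)]
    refine Finset.sum_eq_zero fun j _ => ?_
    by_cases hj : j < n
    · have h1 := circleCoeff_sub hgi hFi j
      rw [circleCoeff_onCircle, hF, coeff_circleProj, if_pos hj, sub_self, circleCoeff,
        mul_eq_zero, inv_eq_zero] at h1
      rw [h1.resolve_left (by exact_mod_cast (by positivity : (2 * π : ℝ) ≠ 0)), mul_zero]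
    · rw [hF, coeff_circleProj, if_neg hj, map_zero, zero_mul]
  have h := lpNorm_add_sq (hg.sub (memLp_onCircle F ∞)) (memLp_onCircle F ∞) ho
  rw [sub_add_cancel] at h
  refine abs_le_of_sq_le_sq' ?_ lpNorm_nonneg |>.2
  rw [h]
  nlinarith [sq_nonneg (lpNorm (g - onCircle F) (2 : ℕ) circleMeasure)]

theorem coeff_X_pow_mul_divByMonic (Q : ℂ[X]) (m i : ℕ) :
    (X ^ m * (Q /ₘ X ^ m)).coeff i = if i < m then 0 else Q.coeff i := by
  split_ifs with h
  · exact X_pow_dvd_iff.1 (dvd_mul_right _ _) i h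
  · conv_rhs => rw [← modByMonic_add_div Q (X ^ m)]
    rw [coeff_add, coeff_eq_zero_of_degree_lt (p := Q %ₘ X ^ m), zero_add]
    refine (degree_modByMonic_lt Q (monic_X_pow m)).trans_le ?_
    rw [degree_X_pow]
    exact_mod_cast not_lt.1 h

theorem lpNorm_X_pow_mul_divByMonic_le (k m : ℕ) (Q : ℂ[X]) :
    lpNorm (onCircle (X ^ m * (Q /ₘ X ^ m))) (2 ^ (k + 1) : ℕ) circleMeasure ≤
      2 ^ (k + 1) * lpNorm (onCircle Q) (2 ^ (k + 1) : ℕ) circleMeasure := by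
  have hd := degree_modByMonic_lt Q (monic_X_pow m)
  rw [degree_X_pow] at hd
  have h := lpNorm_tail_le k m _ _ (dvd_mul_right _ (Q /ₘ X ^ m)) hd
  rw [add_comm (X ^ m * _), modByMonic_add_div] at h
  refine h.trans (mul_le_mul_of_nonneg_right (by linarith) lpNorm_nonneg)

theorem lpNorm_congr_norm {f g : ℝ → ℂ} (hf : AEStronglyMeasurable f circleMeasure)
    (hg : AEStronglyMeasurable g circleMeasure) (h : ∀ θ, ‖f θ‖ = ‖g θ‖) (p : ℝ≥0∞) :
    lpNorm f p circleMeasure = lpNorm g p circleMeasure := by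
  rw [← lpNorm_norm hf, ← lpNorm_norm hg]
  simp [h]

/-- The trigonometric polynomial `e^{-imθ} Q(e^{iθ})`. -/
noncomputable def trigPoly (m : ℕ) (Q : ℂ[X]) (θ : ℝ) : ℂ :=
  (starRingEnd ℂ) (onCircle (X ^ m) θ) * onCircle Q θ

theorem norm_trigPoly (m : ℕ) (Q : ℂ[X]) (θ : ℝ) : ‖trigPoly m Q θ‖ = ‖onCircle Q θ‖ := by
  simp [trigPoly, norm_onCircle_X_pow]

theorem continuous_trigPoly (m : ℕ) (Q : ℂ[X]) : Continuous (trigPoly m Q) :=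
  (Complex.continuous_conj.comp (continuous_onCircle _)).mul (continuous_onCircle Q)

theorem memLp_trigPoly (m : ℕ) (Q : ℂ[X]) (p : ℝ≥0∞) : MemLp (trigPoly m Q) p circleMeasure :=
  (memLp_onCircle Q p).of_le (continuous_trigPoly m Q).aestronglyMeasurable
    (Filter.Eventually.of_forall fun θ => (norm_trigPoly m Q θ).le)

theorem circleCoeff_trigPoly (m : ℕ) (Q : ℂ[X]) (j : ℕ) :
    circleCoeff (trigPoly m Q) j = Q.coeff (m + j) := by
  rw [← circleCoeff_onCircle]
  unfold circleCoeff trigPoly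
  simp only [pow_add, onCircle_mul, Pi.mul_apply, map_mul]
  congr 2
  funext θ
  ring

/-- The projection keeps the window `m ≤ i < m + n` of the coefficients of `Q`, which is the
difference of two tails. Each tail is covered by Riesz's theorem for polynomials. -/
theorem X_pow_mul_circleProj_trigPoly (n m : ℕ) (Q : ℂ[X]) :
    X ^ m * circleProj n (trigPoly m Q) =
      X ^ m * (Q /ₘ X ^ m) - X ^ (m + n) * (Q /ₘ X ^ (m + n)) := by
  ext i
  rw [coeff_sub, coeff_X_pow_mul_divByMonic, coeff_X_pow_mul_divByMonic, coeff_X_pow_mul']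
  by_cases h : m ≤ i
  · rw [if_pos h, coeff_circleProj, circleCoeff_trigPoly, Nat.add_sub_cancel' h]
    by_cases h2 : i - m < n
    · rw [if_pos h2, if_neg (by omega), if_pos (by omega), sub_zero]
    · rw [if_neg h2, if_neg (by omega), if_neg (by omega), sub_self]
  · rw [if_neg h, if_pos (by omega), if_pos (by omega), sub_zero]

theorem lpNorm_circleProj_trigPoly_le (k n m : ℕ) (Q : ℂ[X]) :
    lpNorm (onCircle (circleProj n (trigPoly m Q))) (2 ^ (k + 1) : ℕ) circleMeasure ≤
      2 * 2 ^ (k + 1) * lpNorm (trigPoly m Q) (2 ^ (k + 1) : ℕ) circleMeasure := by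
  rw [lpNorm_congr_norm (memLp_trigPoly m Q 1).1 (memLp_onCircle Q 1).1 (norm_trigPoly m Q),
    lpNorm_congr_norm (g := onCircle (X ^ m * circleProj n (trigPoly m Q)))
      (memLp_onCircle _ 1).1 (memLp_onCircle _ 1).1
      (fun θ => by rw [onCircle_mul]; simp [norm_onCircle_X_pow]),
    X_pow_mul_circleProj_trigPoly, onCircle_sub]
  refine (lpNorm_sub_le (memLp_onCircle _ _) (by exact_mod_cast Nat.one_le_two_pow)).trans ?_
  linarith [lpNorm_X_pow_mul_divByMonic_le k m Q, lpNorm_X_pow_mul_divByMonic_le k (m + n) Q]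

/-- Reduction to a common denominator, so that the density argument can run by induction over a
linear span. -/
theorem trigPoly_add (m m' : ℕ) (Q Q' : ℂ[X]) (θ : ℝ) :
    trigPoly m Q θ + trigPoly m' Q' θ = trigPoly (m + m') (X ^ m' * Q + X ^ m * Q') θ := by
  have h : ∀ j, (starRingEnd ℂ) (onCircle (X ^ j) θ) * onCircle (X ^ j) θ = 1 := by
    intro j
    rw [Complex.conj_mul', norm_onCircle_X_pow]; simp
  simp only [trigPoly, pow_add, onCircle_mul, onCircle_add, Pi.add_apply, Pi.mul_apply, map_mul]
  linear_combination
    (-(starRingEnd ℂ) (onCircle (X ^ m) θ) * onCircle Q θ) * h m' -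
      (starRingEnd ℂ) (onCircle (X ^ m') θ) * onCircle Q' θ * h m

theorem trigPoly_smul (c : ℂ) (m : ℕ) (Q : ℂ[X]) (θ : ℝ) :
    c * trigPoly m Q θ = trigPoly m (C c * Q) θ := by
  simp [trigPoly, onCircle]
  ring

theorem onCircle_X_pow (m : ℕ) (θ : ℝ) : onCircle (X ^ m) θ = Complex.exp (m * (θ * Complex.I)) := by
  simp [onCircle, Complex.exp_nat_mul]

theorem exists_trigPoly_eq_fourier (n : ℤ) :
    ∃ m Q, ∀ θ : ℝ, (fourier n (θ : AddCircle (2 * π)) : ℂ) = trigPoly m Q θ := by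
  obtain ⟨a, m, rfl⟩ : ∃ a m : ℕ, n = (a : ℤ) - m := ⟨n.toNat, (-n).toNat, by omega⟩
  refine ⟨m, X ^ a, fun θ => ?_⟩
  rw [fourier_coe_apply, trigPoly, onCircle_X_pow, onCircle_X_pow, ← Complex.exp_conj,
    ← Complex.exp_add]
  congr 1
  have hpi : (π : ℂ) ≠ 0 := by exact_mod_cast Real.pi_ne_zero
  simp only [map_mul, map_natCast, Complex.conj_ofReal, Complex.conj_I]
  push_cast
  field_simp
  ring

/-- Density of the Fourier monomials in `L^p` of `AddCircle (2 * π)`, transported to the interval.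
-/
theorem exists_lpNorm_sub_trigPoly_lt {g : ℝ → ℂ} (p : ℝ≥0∞) [Fact (1 ≤ p)] (hp : p ≠ ∞)
    (hg : MemLp g p circleMeasure) {δ : ℝ} (hδ : 0 < δ) :
    ∃ m Q, lpNorm (g - trigPoly m Q) p circleMeasure < δ := by
  have : Fact (0 < 2 * π) := ⟨by positivity⟩
  have hmp : MeasurePreserving (fun θ : ℝ => (θ : AddCircle (2 * π))) circleMeasure volume := by
    have := AddCircle.measurePreserving_mk (2 * π) (-π)
    rwa [show -π + 2 * π = π by ring] at this
  have hG : MemLp (AddCircle.liftIoc (2 * π) (-π) g) p volume := by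
    refine MemLp.memLp_liftIoc ?_
    rwa [show -π + 2 * π = π by ring]
  have hGh := memLp_haarAddCircle_iff.2 hG
  set T : ℝ≥0∞ := ENNReal.ofReal (2 * π) ^ (1 / p).toReal with hT
  -- The factor `T` accounts for the passage from normalized Haar measure to arc length, of total
  -- mass `2π`.
  obtain ⟨η, hη, hηδ⟩ : ∃ η : ℝ, 0 < η ∧ T.toReal * η < δ := by
    refine ⟨δ / (T.toReal + 1), by positivity, ?_⟩
    rw [mul_div_assoc', div_lt_iff₀ (by positivity)]
    nlinarith [ENNReal.toReal_nonneg (a := T)]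
  have hmem : hGh.toLp _ ∈
      closure (Submodule.span ℂ (Set.range (@fourierLp (2 * π) _ p _)) : Set _) := by
    rw [← Submodule.topologicalClosure_coe, span_fourierLp_closure_eq_top hp]
    trivial
  obtain ⟨s, hs, hsη⟩ := Metric.mem_closure_iff.1 hmem η hη
  have hrep : ∀ s ∈ Submodule.span ℂ (Set.range (@fourierLp (2 * π) _ p _)),
      ∃ m Q, ∀ᵐ θ : ℝ ∂circleMeasure, s (θ : AddCircle (2 * π)) = trigPoly m Q θ := by
    have hq : ∀ {P : AddCircle (2 * π) → Prop}, (∀ᵐ x ∂AddCircle.haarAddCircle, P x) →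
        ∀ᵐ θ : ℝ ∂circleMeasure, P θ := fun {P} h => by
      refine hmp.quasiMeasurePreserving.ae ?_
      rw [AddCircle.volume_eq_smul_haarAddCircle]
      exact Measure.ae_smul_measure h _
    intro s hs
    induction hs using Submodule.span_induction with
    | mem x hx =>
      obtain ⟨n, rfl⟩ := hx
      obtain ⟨m, Q, h⟩ := exists_trigPoly_eq_fourier n
      refine ⟨m, Q, ?_⟩
      filter_upwards [hq (coeFn_fourierLp p n)] with θ hθ
      rw [hθ, h]
    | zero =>
      refine ⟨0, 0, ?_⟩
      filter_upwards [hq (Lp.coeFn_zero ℂ p AddCircle.haarAddCircle)] with θ hθ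
      rw [hθ]
      simp [trigPoly, onCircle]
    | add x y _ _ hx hy =>
      obtain ⟨m, Q, h⟩ := hx
      obtain ⟨m', Q', h'⟩ := hy
      refine ⟨m + m', X ^ m' * Q + X ^ m * Q', ?_⟩
      filter_upwards [hq (Lp.coeFn_add x y), h, h'] with θ hθ h1 h2
      rw [hθ, Pi.add_apply, h1, h2, trigPoly_add]
    | smul c x _ hx =>
      obtain ⟨m, Q, h⟩ := hx
      refine ⟨m, C c * Q, ?_⟩
      filter_upwards [hq (Lp.coeFn_smul c x), h] with θ hθ h1
      rw [hθ, Pi.smul_apply, h1, smul_eq_mul, trigPoly_smul]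
  obtain ⟨m, Q, hQ⟩ := hrep s hs
  refine ⟨m, Q, lt_of_le_of_lt ?_ hηδ⟩
  have hsub := (Lp.memLp s)
  have hd : (eLpNorm (fun x => AddCircle.liftIoc (2 * π) (-π) g x - s x) p AddCircle.haarAddCircle).toReal < η := by
    rw [dist_eq_norm, Lp.norm_def] at hsη
    rwa [eLpNorm_congr_ae] at hsη
    filter_upwards [Lp.coeFn_sub (hGh.toLp _) s, hGh.coeFn_toLp] with x h1 h2
    rw [h1, Pi.sub_apply, h2]
  have hGs : AEStronglyMeasurable (fun x => AddCircle.liftIoc (2 * π) (-π) g x - s x)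
      (volume : Measure (AddCircle (2 * π))) :=
    hG.1.sub (memLp_haarAddCircle_iff.1 hsub).1
  have hcomp : eLpNorm (g - trigPoly m Q) p circleMeasure =
      eLpNorm (fun x => AddCircle.liftIoc (2 * π) (-π) g x - s x) p volume := by
    rw [← eLpNorm_comp_measurePreserving hGs hmp]
    refine eLpNorm_congr_ae ?_
    have hmemIoc : ∀ᵐ θ ∂circleMeasure, θ ∈ Set.Ioc (-π) π := ae_restrict_mem measurableSet_Ioc
    filter_upwards [hQ, hmemIoc] with θ h1 h2
    simp only [Pi.sub_apply, Function.comp_apply]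
    rw [h1, AddCircle.liftIoc_coe_apply]
    rwa [show -π + 2 * π = π by ring]
  rw [← toReal_eLpNorm (hg.1.sub (continuous_trigPoly m Q).aestronglyMeasurable), hcomp,
    AddCircle.volume_eq_smul_haarAddCircle, eLpNorm_smul_measure_of_ne_top hp, smul_eq_mul,
    ENNReal.toReal_mul]
  exact mul_le_mul_of_nonneg_left hd.le ENNReal.toReal_nonneg

theorem exists_lpNorm_one_le (p : ℝ≥0∞) (hp : 1 ≤ p) :
    ∃ K : ℝ, 0 ≤ K ∧ ∀ g : ℝ → ℂ, MemLp g p circleMeasure →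
      ∫ θ, ‖g θ‖ ∂circleMeasure ≤ K * lpNorm g p circleMeasure := by
  refine ⟨(circleMeasure Set.univ ^ (1 / (1 : ℝ≥0∞).toReal - 1 / p.toReal)).toReal,
    ENNReal.toReal_nonneg, fun g hg => ?_⟩
  rw [← lpNorm_one_eq_integral_norm hg.1, ← toReal_eLpNorm hg.1, ← toReal_eLpNorm hg.1,
    ← ENNReal.toReal_mul, mul_comm]
  refine ENNReal.toReal_mono (ENNReal.mul_ne_top hg.2.ne ?_)
    (eLpNorm_le_eLpNorm_mul_rpow_measure_univ hp hg.1)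
  refine (ENNReal.rpow_lt_top_of_nonneg ?_ (measure_ne_top _ _)).ne
  rw [sub_nonneg, ENNReal.toReal_one]
  by_cases h : p = ∞
  · simp [h]
  · have : 1 ≤ p.toReal := by
      rw [← ENNReal.toReal_one]; exact ENNReal.toReal_mono h hp
    exact one_div_le_one_div_of_le one_pos this

/-- A crude constant that may depend on `n` and `p`: it serves only as continuity of the projection
when passing to the limit from trigonometric polynomials. -/
theorem exists_lpNorm_circleProj_le (n : ℕ) (p : ℝ≥0∞) (hp : 1 ≤ p) :
    ∃ K : ℝ, 0 ≤ K ∧ ∀ g : ℝ → ℂ, MemLp g p circleMeasure →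
      lpNorm (onCircle (circleProj n g)) p circleMeasure ≤ K * lpNorm g p circleMeasure := by
  obtain ⟨K, hK, h⟩ := exists_lpNorm_one_le p hp
  refine ⟨∑ j ∈ Finset.range n, ((2 * π)⁻¹ * K) * lpNorm (onCircle (X ^ j)) p circleMeasure,
    Finset.sum_nonneg fun j _ => mul_nonneg (by positivity) lpNorm_nonneg, fun g hg => ?_⟩
  have h1 : onCircle (circleProj n g) =
      ∑ j ∈ Finset.range n, circleCoeff g j • onCircle (X ^ j) := by
    ext θ
    simp [onCircle, circleProj, eval_finsetSum, Finset.sum_apply]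
  rw [h1, Finset.sum_mul]
  refine (lpNorm_sum_le (fun j _ => (memLp_onCircle _ _).const_smul _) hp).trans
    (Finset.sum_le_sum fun j _ => ?_)
  rw [lpNorm_const_smul, mul_right_comm, coe_nnnorm]
  refine mul_le_mul_of_nonneg_right ?_ lpNorm_nonneg
  rw [circleCoeff, norm_mul, mul_assoc]
  refine mul_le_mul (by simp [abs_of_pos Real.pi_pos]) ?_ (norm_nonneg _) (by positivity)
  refine (norm_integral_le_integral_norm _).trans (le_trans (le_of_eq ?_) (h g hg))
  simp [norm_onCircle_X_pow]

/-- M. Riesz's theorem for the projection onto the span of `1, z, …, z^{n-1}`, in `L^p` with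
`p = 2, 4, 8, …`, with a bound linear in `p`. -/
theorem lpNorm_circleProj_le (k n : ℕ) {g : ℝ → ℂ} (hg : MemLp g ∞ circleMeasure) :
    lpNorm (onCircle (circleProj n g)) (2 ^ (k + 1) : ℕ) circleMeasure ≤
      2 * 2 ^ (k + 1) * lpNorm g (2 ^ (k + 1) : ℕ) circleMeasure := by
  set p := 2 ^ (k + 1) with hp
  have hp1 : (1 : ℝ≥0∞) ≤ (p : ℕ) := by exact_mod_cast Nat.one_le_two_pow
  have : Fact ((1 : ℝ≥0∞) ≤ (p : ℕ)) := ⟨hp1⟩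
  obtain ⟨K, hK, h⟩ := exists_lpNorm_circleProj_le n p hp1
  refine le_of_forall_pos_le_add fun η hη => ?_
  set A : ℝ := 2 * 2 ^ (k + 1) with hA
  have hA0 : 0 ≤ A := by positivity
  have hgp : MemLp g p circleMeasure := MemLp.of_top hg _
  -- An approximation error `e` costs at most `(A + K) e`: `A e` from the norm of the approximant
  -- and `K e` from projecting the difference.
  obtain ⟨m, Q, hQ⟩ := exists_lpNorm_sub_trigPoly_lt p (by simp) hgp
    (δ := η / (A + K + 1)) (by positivity)
  have htp := memLp_trigPoly m Q p
  have h1 := h _ (hgp.sub htp)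
  have h2 := lpNorm_circleProj_trigPoly_le k n m Q
  rw [← hA, ← hp] at h2
  rw [circleProj_sub (hgp.integrable hp1) (htp.integrable hp1), onCircle_sub] at h1
  have h3 := lpNorm_add_le (g := onCircle (circleProj n g) - onCircle (circleProj n (trigPoly m Q)))
    (memLp_onCircle (circleProj n (trigPoly m Q)) p) hp1
  rw [add_sub_cancel] at h3
  have h4 := lpNorm_sub_le (g := g - trigPoly m Q) hgp hp1
  rw [sub_sub_cancel] at h4
  set e := lpNorm (g - trigPoly m Q) p circleMeasure
  have he : 0 ≤ e := lpNorm_nonneg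
  rw [lt_div_iff₀ (by positivity)] at hQ
  nlinarith [mul_le_mul_of_nonneg_left h4 hA0]

/-! ### Multiplication followed by projection. -/

/-- The operator `P ↦ proj_n (a P)` on polynomials, for a real multiplier `a` on the circle. -/
noncomputable def multProj (n : ℕ) (a : ℝ → ℝ) (P : ℂ[X]) : ℂ[X] :=
  circleProj n fun θ => (a θ : ℂ) * onCircle P θ

structure IsMultiplierBound (a : ℝ → ℝ) (q : ℝ) : Prop where
  aemeasurable : AEMeasurable a circleMeasure
  nonneg : 0 ≤ q
  abs_le : ∀ᵐ θ ∂circleMeasure, |a θ| ≤ q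

namespace IsMultiplierBound
variable {a : ℝ → ℝ} {q : ℝ}

theorem ae_norm_le (h : IsMultiplierBound a q) (P : ℂ[X]) :
    ∀ᵐ θ ∂circleMeasure, ‖(a θ : ℂ) * onCircle P θ‖ ≤ q * ‖onCircle P θ‖ := by
  filter_upwards [h.abs_le] with θ hθ
  rw [norm_mul, Complex.norm_real, Real.norm_eq_abs]
  exact mul_le_mul_of_nonneg_right hθ (norm_nonneg _)

theorem memLp (h : IsMultiplierBound a q) (P : ℂ[X]) (p : ℝ≥0∞) :
    MemLp (fun θ => (a θ : ℂ) * onCircle P θ) p circleMeasure :=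
  (memLp_onCircle P p).of_le_mul ((Complex.measurable_ofReal.comp_aemeasurable
    h.aemeasurable).aestronglyMeasurable.mul (continuous_onCircle P).aestronglyMeasurable)
    (h.ae_norm_le P)

theorem lpNorm_le (h : IsMultiplierBound a q) (P : ℂ[X]) (p : ℝ≥0∞) :
    lpNorm (fun θ => (a θ : ℂ) * onCircle P θ) p circleMeasure ≤
      q * lpNorm (onCircle P) p circleMeasure := by
  have h1 := eLpNorm_le_mul_eLpNorm_of_ae_le_mul (h.ae_norm_le P) p
  rw [← toReal_eLpNorm (h.memLp P p).1, ← toReal_eLpNorm (memLp_onCircle P p).1,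
    ← ENNReal.toReal_ofReal h.nonneg, ← ENNReal.toReal_mul]
  exact ENNReal.toReal_mono (ENNReal.mul_ne_top (by simp) (memLp_onCircle P p).2.ne) h1

theorem lpNorm_two_multProj_le (h : IsMultiplierBound a q) (n : ℕ) (P : ℂ[X]) :
    lpNorm (onCircle (multProj n a P)) (2 : ℕ) circleMeasure ≤
      q * lpNorm (onCircle P) (2 : ℕ) circleMeasure :=
  (lpNorm_two_circleProj_le (h.memLp P ∞) n).trans (h.lpNorm_le P _)

theorem lpNorm_multProj_le (h : IsMultiplierBound a q) (k n : ℕ) (P : ℂ[X]) :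
    lpNorm (onCircle (multProj n a P)) (2 ^ (k + 1) : ℕ) circleMeasure ≤
      2 * 2 ^ (k + 1) * q * lpNorm (onCircle P) (2 ^ (k + 1) : ℕ) circleMeasure := by
  rw [mul_assoc]
  exact (lpNorm_circleProj_le k n (h.memLp P ∞)).trans
    (mul_le_mul_of_nonneg_left (h.lpNorm_le P _) (by positivity))

theorem multProj_sub (h : IsMultiplierBound a q) (n : ℕ) (P Q : ℂ[X]) :
    multProj n a (P - Q) = multProj n a P - multProj n a Q := by
  unfold multProj
  rw [← circleProj_sub ((h.memLp P 1).integrable le_rfl) ((h.memLp Q 1).integrable le_rfl)]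
  congr 1
  funext θ
  simp [onCircle_sub, mul_sub]

end IsMultiplierBound

/-! ### The integral equation for the orthogonal polynomials. -/

theorem weightedPairing_X_pow_monicOrthogonal {w : ℝ → ℝ} (hw : IsWeight w) {n j : ℕ}
    (hj : j < n) : weightedPairing w (X ^ j) (monicOrthogonal w n) = 0 := by
  have ho : ∀ m, m < n → weightedPairing w (monicOrthogonal w m) (monicOrthogonal w n) = 0 := by
    intro m hm
    rw [← pairing_conj, (isMonicOrthogonalSystem_monicOrthogonal hw).orthogonal n m hm, map_zero]
  have h := ho j hj
  rw [monicOrthogonal, pairing_sub hw, pairing_sum_C_mul hw, Finset.sum_eq_zero, sub_zero] at h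
  · exact h
  · intro i _
    rw [ho i (i.isLt.trans hj), mul_zero]

theorem circleCoeff_weight_mul_monicOrthogonal {w : ℝ → ℝ} (hw : IsWeight w) {n j : ℕ}
    (hj : j < n) (c : ℝ) :
    circleCoeff (fun θ => ((w θ / c : ℝ) : ℂ) * onCircle (monicOrthogonal w n) θ) j = 0 := by
  have h := congrArg (starRingEnd ℂ) (weightedPairing_X_pow_monicOrthogonal hw hj)
  rw [pairing_conj, map_zero, weightedPairing] at h
  have h2 : (fun θ => ((w θ / c : ℝ) : ℂ) * onCircle (monicOrthogonal w n) θ *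
      (starRingEnd ℂ) (onCircle (X ^ j) θ)) = fun θ => (c : ℂ)⁻¹ *
        (onCircle (monicOrthogonal w n) θ * (starRingEnd ℂ) (onCircle (X ^ j) θ) * (w θ : ℂ)) := by
    funext θ
    push_cast
    ring
  rw [circleCoeff, h2, integral_const_mul, h, mul_zero, mul_zero]

/-- The integral equation satisfied by the monic orthogonal polynomials. -/
theorem monicOrthogonal_eq_add_multProj {w : ℝ → ℝ} (hw : IsWeight w) (n : ℕ) {c q : ℝ}
    (ha : IsMultiplierBound (fun θ => 1 - w θ / c) q) :
    monicOrthogonal w n =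
      X ^ n + multProj n (fun θ => 1 - w θ / c) (monicOrthogonal w n) := by
  obtain ⟨hm, hd⟩ := monicOrthogonal_degree w n
  set Φ := monicOrthogonal w n with hΦ
  have hΦi := (memLp_onCircle Φ 1).integrable le_rfl
  have hai := (ha.memLp Φ 1).integrable le_rfl
  ext i
  rw [coeff_add, multProj, coeff_circleProj, coeff_X_pow]
  -- Below `n`, the coefficients of `Φ` and `(1 - w/c) Φ` differ by those of `(w/c) Φ`, which vanish
  -- by orthogonality. At `n` only monicity matters, since the projection stops at `n - 1`.
  rcases lt_trichotomy i n with h | rfl | h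
  · have h1 := circleCoeff_sub hΦi hai i
    have h2 : onCircle Φ - (fun θ => ((1 - w θ / c : ℝ) : ℂ) * onCircle Φ θ) =
        fun θ => ((w θ / c : ℝ) : ℂ) * onCircle Φ θ := by
      funext θ
      simp only [Pi.sub_apply]
      push_cast
      ring
    rw [h2, circleCoeff_weight_mul_monicOrthogonal hw h, circleCoeff_onCircle] at h1
    rw [if_neg h.ne, if_pos h, zero_add]
    exact sub_eq_zero.1 h1.symm
  · have := hm.coeff_natDegree
    rw [hd] at this
    simp [this]
  · rw [coeff_eq_zero_of_natDegree_lt (by omega), if_neg h.ne', if_neg (by omega), zero_add]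

/-! ### Weights close to `1`. -/

theorem lpNorm_onCircle_X_pow (n : ℕ) {p : ℕ} (hp : 0 < p) :
    lpNorm (onCircle (X ^ n)) p circleMeasure ^ p = 2 * π := by
  rw [lpNorm_pow_eq_integral (memLp_onCircle _ 1).1 hp]
  simp [norm_onCircle_X_pow, circleMeasure_real_univ]

theorem IsWeightBetween.isMultiplierBound_one {ε : ℝ} {w : ℝ → ℝ} (hε : 0 ≤ ε)
    (hw : IsWeightBetween (1 + ε) w) : IsMultiplierBound (fun θ => 1 - w θ / 1) ε where
  aemeasurable := (hw.aemeasurable.div_const 1).const_sub 1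
  nonneg := hε
  abs_le := by
    filter_upwards [hw.one_le, hw.le] with θ h1 h2
    rw [abs_le]
    constructor <;> linarith

/-- Dividing by the upper bound makes the multiplier a strict contraction for every finite `M`, with
gap exactly `1 / M`. -/
theorem IsWeightBetween.isMultiplierBound_div {M : ℝ} {w : ℝ → ℝ} (hM : 1 ≤ M)
    (hw : IsWeightBetween M w) : IsMultiplierBound (fun θ => 1 - w θ / M) (1 - 1 / M) where
  aemeasurable := (hw.aemeasurable.div_const M).const_sub 1
  nonneg := by rw [sub_nonneg, div_le_one (by linarith)]; exact hM
  abs_le := by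
    filter_upwards [hw.one_le, hw.le] with θ h1 h2
    have h3 : w θ / M ≤ 1 := (div_le_one (by linarith)).2 h2
    have h4 : 1 / M ≤ w θ / M := div_le_div_of_nonneg_right h1 (by linarith)
    rw [abs_of_nonneg (by linarith)]
    linarith

/-- The operator has `L²` norm at most `1 - 1/M`, so solving the integral equation loses at most a
factor `M`. -/
theorem lpNorm_two_monicOrthogonal_le {M : ℝ} {w : ℝ → ℝ} (hM : 1 ≤ M)
    (hw : IsWeightBetween M w) (n : ℕ) :
    lpNorm (onCircle (monicOrthogonal w n)) (2 : ℕ) circleMeasure ^ 2 ≤ M ^ 2 * (2 * π) := by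
  have ha := hw.isMultiplierBound_div hM
  have h1 := ha.lpNorm_two_multProj_le n (monicOrthogonal w n)
  have h2 := lpNorm_add_le (g := onCircle (multProj n (fun θ => 1 - w θ / M) (monicOrthogonal w n)))
    (memLp_onCircle (X ^ n) (2 : ℕ)) (by norm_num)
  rw [← onCircle_add, ← monicOrthogonal_eq_add_multProj hw.isWeight n ha] at h2
  rw [← lpNorm_onCircle_X_pow n two_pos, ← mul_pow]
  refine pow_le_pow_left₀ lpNorm_nonneg ?_ 2
  rw [mul_comm, ← div_le_iff₀ (by linarith), div_eq_mul_one_div]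
  linarith

theorem norm_monicOrthogonal_le_sqrt {M : ℝ} {w : ℝ → ℝ} (hM : 1 ≤ M)
    (hw : IsWeightBetween M w) {n : ℕ} (hn : 1 ≤ n) (θ : ℝ) :
    ‖onCircle (monicOrthogonal w n) θ‖ ≤ 2 * M * (n : ℝ) ^ ((1 : ℝ) / 2) := by
  have h := norm_onCircle_sq_le (monicOrthogonal w n) θ
  rw [(monicOrthogonal_degree w n).2] at h
  have hn' : (1 : ℝ) ≤ n := by exact_mod_cast hn
  refine abs_le_of_sq_le_sq' (h.trans ?_) (by positivity) |>.2
  refine (mul_le_mul_of_nonneg_left (lpNorm_two_monicOrthogonal_le hM hw n)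
    (by positivity)).trans ?_
  rw [← Real.sqrt_eq_rpow, mul_pow, Real.sq_sqrt (by positivity)]
  have : ((n : ℝ) + 1) / (2 * π) * (M ^ 2 * (2 * π)) = (n + 1) * M ^ 2 := by
    field_simp
  rw [this]
  nlinarith [sq_nonneg M, mul_nonneg (sq_nonneg M) (by linarith : (0:ℝ) ≤ n - 1)]

/-- With `p = 2^(k+1)`, the hypothesis `4pε ≤ 1` makes the Riesz bound `2pε` at most `1/2`, so the
last term of the integral equation can be absorbed in `L^p`. Nikolskii's inequality concludes. -/
theorem norm_monicOrthogonal_le_of_small {ε : ℝ} {w : ℝ → ℝ} (hε : 0 ≤ ε)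
    (hw : IsWeightBetween (1 + ε) w) {k n : ℕ} (hn : 1 ≤ n) (hk : 4 * 2 ^ (k + 1) * ε ≤ 1)
    (θ : ℝ) :
    ‖onCircle (monicOrthogonal w n) θ‖ ≤ 4 * (n : ℝ) ^ ((1 : ℝ) / 2 ^ (k + 1)) := by
  have ha := hw.isMultiplierBound_one hε
  set Φ := monicOrthogonal w n with hΦ
  have h1 := ha.lpNorm_multProj_le k n Φ
  have hpe : 2 ^ (k + 1) = 2 * 2 ^ k := by ring
  have h4 := norm_onCircle_pow_le Φ (j := 2 ^ k) (by positivity) θ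
  rw [(monicOrthogonal_degree w n).2, ← hpe] at h4
  have hjp : ((2 ^ k : ℕ) : ℝ) = ((2 ^ (k + 1) : ℕ) : ℝ) / 2 := by push_cast; ring
  rw [hjp] at h4
  have hpr : ((2 : ℝ) ^ (k + 1)) = (2 ^ (k + 1) : ℕ) := by push_cast; ring
  rw [hpr] at h1 hk ⊢
  have hp2 : 2 ≤ 2 ^ (k + 1) := by rw [hpe]; linarith [Nat.one_le_two_pow (n := k)]
  generalize 2 ^ (k + 1) = p at *
  have h2 := lpNorm_add_le (g := onCircle (multProj n (fun θ => 1 - w θ / 1) Φ))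
    (memLp_onCircle (X ^ n) p) (by exact_mod_cast (by omega : 1 ≤ p))
  rw [← onCircle_add, ← monicOrthogonal_eq_add_multProj hw.isWeight n ha] at h2
  have h3 : lpNorm (onCircle Φ) p circleMeasure ≤
      2 * lpNorm (onCircle (X ^ n)) p circleMeasure := by
    nlinarith [lpNorm_nonneg (f := onCircle Φ) (p := p) (μ := circleMeasure)]
  have h5 := pow_le_pow_left₀ lpNorm_nonneg h3 p
  rw [mul_pow, lpNorm_onCircle_X_pow n (by omega)] at h5
  have hn' : (1 : ℝ) ≤ n := by exact_mod_cast hn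
  have hp' : (2 : ℝ) ≤ p := by exact_mod_cast hp2
  have hpp : (p : ℝ) ≤ 2 ^ p := by exact_mod_cast Nat.lt_two_pow_self.le
  refine le_of_pow_le_pow_left₀ (by omega : p ≠ 0) (by positivity) (h4.trans ?_)
  refine (mul_le_mul_of_nonneg_left h5 (by positivity)).trans ?_
  rw [mul_pow, ← Real.rpow_natCast ((n : ℝ) ^ (1 / (p : ℝ))), ← Real.rpow_mul (by positivity),
    one_div_mul_cancel (by positivity), Real.rpow_one]
  have e1 : ((n : ℝ) * (p / 2) + 1) / (2 * π) * (2 ^ p * (2 * π)) = (n * (p / 2) + 1) * 2 ^ p := by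
    field_simp
  have e2 : (4 : ℝ) ^ p = 2 ^ p * 2 ^ p := by rw [← mul_pow]; norm_num
  rw [e1, e2]
  have h6 : (n : ℝ) * (p / 2) + 1 ≤ 2 ^ p * n := by nlinarith
  calc ((n : ℝ) * (p / 2) + 1) * 2 ^ p ≤ (2 ^ p * n) * 2 ^ p :=
        mul_le_mul_of_nonneg_right h6 (by positivity)
    _ = _ := by ring

theorem norm_monicOrthogonal_le_rpow {ε : ℝ} {w : ℝ → ℝ} (hε : 0 < ε) (hε1 : ε ≤ 1)
    (hw : IsWeightBetween (1 + ε) w) {n : ℕ} (hn : 1 ≤ n) (θ : ℝ) :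
    ‖onCircle (monicOrthogonal w n) θ‖ ≤ 4 * (n : ℝ) ^ (8 * ε) := by
  have hn' : (1 : ℝ) ≤ n := by exact_mod_cast hn
  by_cases h8 : ε ≤ 1 / 8
  -- The choice `2^k ≤ 1/(8ε) < 2^(k+1)` gives both `4 · 2^(k+1) ε ≤ 1` and `1/2^(k+1) < 8ε`.
  · obtain ⟨k, hk1, hk2⟩ := exists_nat_pow_near (x := 1 / (8 * ε)) (y := 2)
      (by rw [le_div_iff₀ (by positivity)]; linarith) one_lt_two
    rw [le_div_iff₀ (by positivity)] at hk1
    rw [div_lt_iff₀ (by positivity)] at hk2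
    refine (norm_monicOrthogonal_le_of_small hε.le hw hn (k := k) ?_ θ).trans ?_
    · rw [pow_succ]; linarith
    · refine mul_le_mul_of_nonneg_left (Real.rpow_le_rpow_of_exponent_le hn' ?_) (by norm_num)
      rw [div_le_iff₀ (by positivity)]
      linarith
  -- Here `8ε > 1`, so the elementary bound with exponent `1/2` is already enough.
  · push Not at h8
    refine (norm_monicOrthogonal_le_sqrt (by linarith) hw hn θ).trans ?_
    exact mul_le_mul (by linarith) (Real.rpow_le_rpow_of_exponent_le hn' (by linarith))
      (by positivity) (by norm_num)

/-! ### Iterates and the Neumann series. -/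

theorem natDegree_iterate_multProj_le (n : ℕ) (a : ℝ → ℝ) {P : ℂ[X]} (hP : P.natDegree ≤ n)
    (j : ℕ) : ((multProj n a)^[j] P).natDegree ≤ n := by
  cases j with
  | zero => exact hP
  | succ j =>
    rw [Function.iterate_succ_apply']
    exact natDegree_circleProj_le _ _

namespace IsMultiplierBound
variable {a : ℝ → ℝ} {q : ℝ}

theorem lpNorm_two_iterate_le (h : IsMultiplierBound a q) (n : ℕ) (P : ℂ[X]) (j : ℕ) :
    lpNorm (onCircle ((multProj n a)^[j] P)) (2 : ℕ) circleMeasure ≤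
      q ^ j * lpNorm (onCircle P) (2 : ℕ) circleMeasure := by
  induction j with
  | zero => simp
  | succ j ih =>
    rw [Function.iterate_succ_apply', pow_succ', mul_assoc]
    exact (h.lpNorm_two_multProj_le n _).trans (mul_le_mul_of_nonneg_left ih h.nonneg)

/-- The constant is `2p = 8` at `p = 4`. Exponential growth is harmless, because this bound is later
used only with exponent `1/(6T)`. -/
theorem lpNorm_four_iterate_le (h : IsMultiplierBound a q) (hq : q ≤ 1) (n : ℕ) (P : ℂ[X])
    (j : ℕ) :
    lpNorm (onCircle ((multProj n a)^[j] P)) (4 : ℕ) circleMeasure ≤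
      8 ^ j * lpNorm (onCircle P) (4 : ℕ) circleMeasure := by
  induction j with
  | zero => simp
  | succ j ih =>
    rw [Function.iterate_succ_apply', pow_succ', mul_assoc]
    have h1 := h.lpNorm_multProj_le 1 n ((multProj n a)^[j] P)
    rw [show (2 : ℕ) ^ (1 + 1) = 4 by norm_num, show (2 : ℝ) * 2 ^ (1 + 1) = 8 by norm_num] at h1
    refine h1.trans (mul_le_mul (by linarith) ih lpNorm_nonneg (by norm_num))

theorem norm_iterate_le_sqrt (h : IsMultiplierBound a q) {n : ℕ} {P : ℂ[X]}
    (hP : P.natDegree ≤ n) (j : ℕ) (θ : ℝ) :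
    ‖onCircle ((multProj n a)^[j] P) θ‖ ≤ √((n + 1) / (2 * π)) *
      (q ^ j * lpNorm (onCircle P) (2 : ℕ) circleMeasure) := by
  have h1 := norm_onCircle_sq_le ((multProj n a)^[j] P) θ
  have h2 : (((multProj n a)^[j] P).natDegree : ℝ) ≤ n := by
    exact_mod_cast natDegree_iterate_multProj_le n a hP j
  have hq := pow_nonneg h.nonneg j
  refine abs_le_of_sq_le_sq' (h1.trans ?_)
    (mul_nonneg (by positivity) (mul_nonneg hq lpNorm_nonneg)) |>.2
  rw [mul_pow, Real.sq_sqrt (by positivity)]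
  exact mul_le_mul (by gcongr) (pow_le_pow_left₀ lpNorm_nonneg (h.lpNorm_two_iterate_le n P j) 2)
    (by positivity) (by positivity)

theorem norm_iterate_X_pow_le_sqrt (h : IsMultiplierBound a q) {n : ℕ} (hn : 1 ≤ n) (j : ℕ)
    (θ : ℝ) :
    ‖onCircle ((multProj n a)^[j] (X ^ n)) θ‖ ≤ 2 * (n : ℝ) ^ ((1 : ℝ) / 2) * q ^ j := by
  have hn' : (1 : ℝ) ≤ n := by exact_mod_cast hn
  have hq := pow_nonneg h.nonneg j
  refine (h.norm_iterate_le_sqrt (natDegree_X_pow_le n) j θ).trans ?_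
  rw [mul_left_comm, mul_comm]
  refine mul_le_mul_of_nonneg_right ?_ hq
  refine abs_le_of_sq_le_sq' ?_ (by positivity) |>.2
  rw [mul_pow, lpNorm_onCircle_X_pow n two_pos, Real.sq_sqrt (by positivity),
    div_mul_cancel₀ _ (by positivity), ← Real.sqrt_eq_rpow, mul_pow, Real.sq_sqrt (by positivity)]
  linarith

theorem norm_iterate_X_pow_le_four (h : IsMultiplierBound a q) (hq : q ≤ 1) {n : ℕ} (hn : 1 ≤ n)
    (j : ℕ) (θ : ℝ) :
    ‖onCircle ((multProj n a)^[j] (X ^ n)) θ‖ ≤ 2 * (n : ℝ) ^ ((1 : ℝ) / 4) * 8 ^ j := by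
  have hn' : (1 : ℝ) ≤ n := by exact_mod_cast hn
  have h1 := norm_onCircle_pow_le ((multProj n a)^[j] (X ^ n)) two_pos θ
  have h2 : (((multProj n a)^[j] (X ^ n)).natDegree : ℝ) ≤ n := by
    exact_mod_cast natDegree_iterate_multProj_le n a (natDegree_X_pow_le n) j
  have h3 := pow_le_pow_left₀ lpNorm_nonneg (h.lpNorm_four_iterate_le hq n (X ^ n) j) 4
  rw [mul_pow, lpNorm_onCircle_X_pow n (by norm_num)] at h3
  rw [show 2 * 2 = 4 by norm_num] at h1
  refine le_of_pow_le_pow_left₀ (by norm_num : 4 ≠ 0) (by positivity) (h1.trans ?_)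
  calc _ ≤ ((n : ℝ) * (2 : ℕ) + 1) / (2 * π) * ((8 ^ j) ^ 4 * (2 * π)) := by gcongr
    _ = (2 * n + 1) * (8 ^ j) ^ 4 := by push_cast; field_simp
    _ ≤ (16 * n) * (8 ^ j) ^ 4 := by gcongr; linarith
    _ = _ := by
      rw [mul_pow, mul_pow, ← Real.rpow_natCast ((n : ℝ) ^ ((1 : ℝ) / 4)),
        ← Real.rpow_mul (by positivity)]
      norm_num

theorem iterate_sub (h : IsMultiplierBound a q) (n : ℕ) (P Q : ℂ[X]) (j : ℕ) :
    (multProj n a)^[j] (P - Q) = (multProj n a)^[j] P - (multProj n a)^[j] Q := by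
  induction j with
  | zero => rfl
  | succ j ih => simp only [Function.iterate_succ_apply', ih, h.multProj_sub]

/-- The Neumann series of a solution of `P = Q + proj_n (a P)`. -/
theorem eq_sum_iterate_add (h : IsMultiplierBound a q) {n : ℕ} {P Q : ℂ[X]}
    (hP : P = Q + multProj n a P) (J : ℕ) :
    P = ∑ j ∈ Finset.range J, (multProj n a)^[j] Q + (multProj n a)^[J] P := by
  induction J with
  | zero => simp
  | succ J ih =>
    have h1 : multProj n a P = P - Q := eq_sub_of_add_eq' hP.symm
    rw [Finset.sum_range_succ, Function.iterate_succ_apply, h1, h.iterate_sub]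
    conv_lhs => rw [ih]
    ring

end IsMultiplierBound

/-! ### Interpolation and weights with a large upper bound. -/

theorem rpow_pow_right_comm {x : ℝ} (hx : 0 ≤ x) (j : ℕ) (s : ℝ) : (x ^ j) ^ s = (x ^ s) ^ j := by
  rw [← Real.rpow_natCast, ← Real.rpow_natCast, ← Real.rpow_mul hx, ← Real.rpow_mul hx, mul_comm]

theorem le_rpow_mul_rpow {x A B t : ℝ} (hx : 0 ≤ x) (hA : x ≤ A) (hB : x ≤ B) (ht0 : 0 ≤ t)
    (ht1 : t ≤ 1) : x ≤ A ^ (1 - t) * B ^ t :=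
  calc x = x ^ (1 - t) * x ^ t := by
        rw [← Real.rpow_add' hx (by norm_num), sub_add_cancel, Real.rpow_one]
    _ ≤ A ^ (1 - t) * B ^ t := by
        have := sub_nonneg.2 ht1
        gcongr
        exact Real.rpow_nonneg (hx.trans hA) _

/-- With `s = 1/T < 1/2`, the logarithm of the left side is at most `-s(1 - s/6) + (s/6) log 8`.
Since `log 8 ≤ 2.08`, the weight `s/6` is small enough to leave at most `-s/2`. -/
theorem rpow_mul_eight_rpow_le {T : ℝ} (hT : 2 < T) :
    (1 - 1 / T) ^ (1 - 1 / (6 * T)) * (8 : ℝ) ^ (1 / (6 * T)) ≤ (1 + 1 / (2 * T))⁻¹ := by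
  have hs : 0 < 1 / T := by positivity
  have hs1 : 1 / T < 1 / 2 := one_div_lt_one_div_of_lt two_pos hT
  rw [show 1 / (6 * T) = 1 / T / 6 by field_simp, show 1 / (2 * T) = 1 / T / 2 by field_simp]
  generalize 1 / T = s at *
  have h1 : 1 - s ≤ Real.exp (-s) := Real.one_sub_le_exp_neg s
  have h8 : Real.log 8 ≤ 2.08 := by
    rw [show (8 : ℝ) = 2 ^ 3 by norm_num, Real.log_pow]
    push_cast
    linarith [Real.log_two_lt_d9]
  calc (1 - s) ^ (1 - s / 6) * (8 : ℝ) ^ (s / 6)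
      ≤ Real.exp (-s) ^ (1 - s / 6) * (8 : ℝ) ^ (s / 6) := by
        gcongr <;> linarith
    _ = Real.exp (-s * (1 - s / 6) + Real.log 8 * (s / 6)) := by
        rw [← Real.exp_mul, Real.rpow_def_of_pos (by norm_num), Real.exp_add]
    _ ≤ Real.exp (-(s / 2)) := by
        apply Real.exp_le_exp.2
        nlinarith
    _ ≤ (1 + s / 2)⁻¹ := by
        rw [Real.exp_neg]
        refine inv_anti₀ (by linarith) ?_
        linarith [Real.add_one_le_exp (s / 2)]

theorem norm_monicOrthogonal_le_of_large {T : ℝ} {w : ℝ → ℝ} (hT : 2 < T)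
    (hw : IsWeightBetween T w) {n : ℕ} (hn : 1 ≤ n) (θ : ℝ) :
    ‖onCircle (monicOrthogonal w n) θ‖ ≤ 6 * T * (n : ℝ) ^ ((1 : ℝ) / 2 - 1 / 24 * T⁻¹) := by
  have ha := hw.isMultiplierBound_div (by linarith : 1 ≤ T)
  have hq1 : 1 - 1 / T < 1 := by
    have : 0 < 1 / T := by positivity
    linarith
  have hq0 := ha.nonneg
  have hρ := rpow_mul_eight_rpow_le hT
  set q := 1 - 1 / T with hq
  set t := 1 / (6 * T) with ht
  set ρ := (1 + 1 / (2 * T))⁻¹ with hρd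
  set N := (n : ℝ) ^ ((1 : ℝ) / 2 - 1 / 24 * T⁻¹) with hN
  have hn' : (1 : ℝ) ≤ n := by exact_mod_cast hn
  have hN0 : 0 ≤ N := by positivity
  have ht0 : 0 ≤ t := by positivity
  have ht1 : t ≤ 1 := by
    rw [ht, div_le_one (by positivity)]; linarith
  have hρ0 : 0 ≤ ρ := by positivity
  have hρ1 : ρ < 1 := inv_lt_one_of_one_lt₀ (by linarith [show 0 < 1 / (2 * T) by positivity])
  set u : ℕ → ℂ[X] := fun j => (multProj n (fun θ => 1 - w θ / T))^[j] (X ^ n) with hu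
  have hterm : ∀ j, ‖onCircle (u j) θ‖ ≤ 2 * N * ρ ^ j := by
    intro j
    -- The exponent of `n` becomes `(1 - t)/2 + t/4 = 1/2 - t/4`, and `t/4 = 1/(24T)`.
    refine (le_rpow_mul_rpow (norm_nonneg _) (ha.norm_iterate_X_pow_le_sqrt hn j θ)
      (ha.norm_iterate_X_pow_le_four hq1.le hn j θ) ht0 ht1).trans ?_
    have e : (2 * (n : ℝ) ^ ((1 : ℝ) / 2) * q ^ j) ^ (1 - t) *
        (2 * (n : ℝ) ^ ((1 : ℝ) / 4) * 8 ^ j) ^ t =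
        (2 ^ (1 - t) * 2 ^ t) * (((n : ℝ) ^ ((1 : ℝ) / 2)) ^ (1 - t) *
          ((n : ℝ) ^ ((1 : ℝ) / 4)) ^ t) * (q ^ (1 - t) * 8 ^ t) ^ j := by
      rw [Real.mul_rpow (by positivity) (by positivity),
        Real.mul_rpow (by positivity) (by positivity),
        Real.mul_rpow (by positivity) (by positivity),
        Real.mul_rpow (by positivity) (by positivity), mul_pow,
        rpow_pow_right_comm hq0, rpow_pow_right_comm (by norm_num : (0 : ℝ) ≤ 8)]
      ring
    rw [e, ← Real.rpow_add two_pos, sub_add_cancel, Real.rpow_one, ← Real.rpow_mul (by positivity),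
      ← Real.rpow_mul (by positivity), ← Real.rpow_add (by positivity),
      show (1 : ℝ) / 2 * (1 - t) + 1 / 4 * t = 1 / 2 - 1 / 24 * T⁻¹ by rw [ht]; field_simp; ring]
    gcongr
  have hsum : ∀ J, ∑ j ∈ Finset.range J, ‖onCircle (u j) θ‖ ≤ 6 * T * N := by
    intro J
    calc ∑ j ∈ Finset.range J, ‖onCircle (u j) θ‖ ≤ ∑ j ∈ Finset.range J, 2 * N * ρ ^ j :=
          Finset.sum_le_sum fun j _ => hterm j
      _ = 2 * N * ∑ j ∈ Finset.range J, ρ ^ j := by rw [Finset.mul_sum]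
      _ ≤ 2 * N * (1 - ρ)⁻¹ := by
          gcongr
          rw [← tsum_geometric_of_lt_one hρ0 hρ1]
          exact (summable_geometric_of_lt_one hρ0 hρ1).sum_le_tsum _ fun j _ => by positivity
      -- Here `ρ = 2T/(2T + 1)`, hence `1 - ρ = 1/(2T + 1)`.
      _ = 2 * N * (2 * T + 1) := by
          congr 1
          rw [hρd]
          field_simp
          ring
      _ ≤ 6 * T * N := by nlinarith
  set Φ := monicOrthogonal w n with hΦ
  set B := √((n + 1) / (2 * π)) with hB
  -- The remainder after `J` terms needs only the `L²` contraction: its prefactor depends on `n` but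
  -- not on `J`, so it disappears as `J → ∞`.
  have hbound : ∀ J, ‖onCircle Φ θ‖ ≤
      6 * T * N + B * (q ^ J * lpNorm (onCircle Φ) (2 : ℕ) circleMeasure) := by
    intro J
    have h1 := congrArg (fun P => onCircle P θ)
      (ha.eq_sum_iterate_add (monicOrthogonal_eq_add_multProj hw.isWeight n ha) J)
    simp only [onCircle_add, Pi.add_apply] at h1
    rw [h1]
    refine (norm_add_le _ _).trans (add_le_add ?_
      (ha.norm_iterate_le_sqrt (monicOrthogonal_degree w n).2.le J θ))
    refine le_trans ?_ (hsum J)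
    rw [onCircle, eval_finsetSum]
    exact norm_sum_le _ _
  refine ge_of_tendsto' (f := fun J : ℕ =>
    6 * T * N + B * (q ^ J * lpNorm (onCircle Φ) (2 : ℕ) circleMeasure)) (x := .atTop) ?_ hbound
  have := (((tendsto_pow_atTop_nhds_zero_of_lt_one hq0 hq1).mul_const
    (lpNorm (onCircle Φ) (2 : ℕ) circleMeasure)).const_mul B).const_add (6 * T * N)
  simpa using this

theorem supNormMonicOrthogonal_le {n : ℕ} {M B : ℝ}
    (h : ∀ w, IsWeightBetween M w → ∀ θ, ‖onCircle (monicOrthogonal w n) θ‖ ≤ B) :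
    supNormMonicOrthogonal n M ≤ ENNReal.ofReal B := by
  refine iSup₂_le fun w hw => ?_
  rw [eLpNorm_exponent_top]
  exact eLpNormEssSup_le_of_ae_bound (Filter.Eventually.of_forall (h w hw))

theorem corollary1 :
    ∃ C C₃ C₄ : ℝ, 0 < C ∧ 0 < C₃ ∧ 0 < C₄ ∧
      (∀ ε : ℝ, 0 < ε → ε ≤ 1 → ∀ n : ℕ, 1 ≤ n →
        supNormMonicOrthogonal n (1 + ε) ≤ ENNReal.ofReal (C * (n : ℝ) ^ (C₃ * ε))) ∧
      (∀ T : ℝ, 2 < T → ∀ n : ℕ, 1 ≤ n →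
        supNormMonicOrthogonal n T ≤
          ENNReal.ofReal (C * T * (n : ℝ) ^ ((1 : ℝ) / 2 - C₄ * T⁻¹))) := by
  refine ⟨6, 8, 1 / 24, by norm_num, by norm_num, by norm_num, fun ε hε hε1 n hn => ?_,
    fun T hT n hn => ?_⟩
  · refine supNormMonicOrthogonal_le fun w hw θ => ?_
    refine (norm_monicOrthogonal_le_rpow hε hε1 hw hn θ).trans ?_
    gcongr
    norm_num
  · exact supNormMonicOrthogonal_le fun w hw θ => norm_monicOrthogonal_le_of_large hT hw hn θ
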